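/- For $X\in\mathbb R^{n\times p}$ and $B\in\mathbb R^{p\times m}$ let $q=\operatorname{rank}(X)$, let $r(B)=\operatorname{rank}(B)$, let $J(B)$ be the number of nonzero rows of $B$, and set $$P_o(B)=\bigl[\min\{q,J(B)\}+m-r(B)\bigr]\,r(B)+J(B)\log\bigl(ep/J(B)\bigr),$$ where the last summand is $0$ when $J(B)=0$. Let $Y=XB^*+E$, where $X$ and $B^*\in\mathbb R^{p\times m}$ are fixed and the entries of $E\in\mathbb R^{n\times m}$ are i.i.d. $\mathcal N(0,\sigma^2)$ with $\sigma>0$. For a constant $A>0$ let $\delta(B)=A\,P_o(B)/(mn)$, and consider the four criteria $$\frac{\|Y-XB\|_F^2}{1-\delta(B)},\qquad \frac{\|Y-XB\|_F^2}{[1-\delta(B)]^2},\qquad \log\bigl(\|Y-XB\|_F^2\bigr)+\delta(B),\qquad \|Y-XB\|_F^2+\delta(B)\|Y-XB\|_F^2$$ (with $\log 0=-\infty$). There are universal constants $A_{\min},C,c,C',c'>0$ such that for all constants $A,A_0$ with $A_{\min}\le A<A_0$ there is a constant $K>0$, depending only on $A$ and $A_0$, with the following property. For all $n,p,m,X,B^*,\sigma$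 such that $$P_o(B^*)<\frac{mn}{A_0},$$ with probability at least $1-Cp^{-c}-C'\exp(-c'mn)$, every $\hat B$ that minimizes one of the four criteria over all $B\in\mathbb R^{p\times m}$ with $\delta(B)<1$ satisfies $$\|X\hat B-XB^*\|_F^2\le K\,\sigma^2P_o(B^*).$$ -/

import Mathlib

open MeasureTheory ProbabilityTheory
open scoped NNReal ENNReal

/- Throughout, the norm of a real matrix is the Frobenius norm. -/
open scoped Matrix.Norms.Frobenius

noncomputable section

namespace ScaleFreePIC

/-- The row support of `B`: the set of indices of its nonzero rows. -/
def rowSupport {p m : ℕ} (B : Matrix (Fin p) (Fin m) ℝ) : Finset (Fin p) :=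
  Finset.univ.filter fun j => B.row j ≠ 0

/-- The number of nonzero rows of `B`. -/
def numRows {p m : ℕ} (B : Matrix (Fin p) (Fin m) ℝ) : ℕ := (rowSupport B).card

/-- The complexity `[min(q, J) + m - r] r + J log (e p / J)` of `B`, where `q = rank X`,
`J` is the number of nonzero rows of `B` and `r = rank B`. The last summand is `0` for `J = 0`. -/
def complexity {n p m : ℕ} (X : Matrix (Fin n) (Fin p) ℝ) (B : Matrix (Fin p) (Fin m) ℝ) : ℝ :=
  ((min X.rank (numRows B) : ℕ) + (m : ℝ) - (B.rank : ℝ)) * (B.rank : ℝ)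
    + (numRows B : ℝ) * Real.log (Real.exp 1 * (p : ℝ) / (numRows B : ℝ))

/-- The scaled complexity `δ(B) = A P_o(B) / (m n)`. -/
def scaledComplexity {n p m : ℕ} (A : ℝ) (X : Matrix (Fin n) (Fin p) ℝ)
    (B : Matrix (Fin p) (Fin m) ℝ) : ℝ :=
  A * complexity X B / ((m : ℝ) * (n : ℝ))

/-- The residual sum of squares. -/
def rss {n p m : ℕ} (X : Matrix (Fin n) (Fin p) ℝ) (Y : Matrix (Fin n) (Fin m) ℝ)
    (B : Matrix (Fin p) (Fin m) ℝ) : ℝ :=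
  ‖Y - X * B‖ ^ 2

/-- The fractional form. -/
def fractionalForm {n p m : ℕ} (A : ℝ) (X : Matrix (Fin n) (Fin p) ℝ)
    (Y : Matrix (Fin n) (Fin m) ℝ) (B : Matrix (Fin p) (Fin m) ℝ) : ℝ :=
  rss X Y B / (1 - scaledComplexity A X B)

/-- The GCV form. -/
def gcvForm {n p m : ℕ} (A : ℝ) (X : Matrix (Fin n) (Fin p) ℝ)
    (Y : Matrix (Fin n) (Fin m) ℝ) (B : Matrix (Fin p) (Fin m) ℝ) : ℝ :=
  rss X Y B / (1 - scaledComplexity A X B) ^ 2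

/-- The logarithmic form, with values in the extended reals, so that `log 0 = -∞`. -/
def logForm {n p m : ℕ} (A : ℝ) (X : Matrix (Fin n) (Fin p) ℝ)
    (Y : Matrix (Fin n) (Fin m) ℝ) (B : Matrix (Fin p) (Fin m) ℝ) : EReal :=
  ENNReal.log (ENNReal.ofReal (rss X Y B)) + (scaledComplexity A X B : EReal)

/-- The plug-in form. -/
def plugInForm {n p m : ℕ} (A : ℝ) (X : Matrix (Fin n) (Fin p) ℝ)
    (Y : Matrix (Fin n) (Fin m) ℝ) (B : Matrix (Fin p) (Fin m) ℝ) : ℝ :=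
  rss X Y B + scaledComplexity A X B * rss X Y B

/-- `Bhat` minimizes the criterion `crit` over all matrices `B` with `δ(B) < 1`. -/
def IsConstrainedMinimizer {n p m : ℕ} {β : Type} [Preorder β] (A : ℝ)
    (X : Matrix (Fin n) (Fin p) ℝ) (crit : Matrix (Fin p) (Fin m) ℝ → β)
    (Bhat : Matrix (Fin p) (Fin m) ℝ) : Prop :=
  scaledComplexity A X Bhat < 1 ∧ IsMinOn crit {B | scaledComplexity A X B < 1} Bhat

/-- `Bhat` minimizes at least one of the four scale-free criteria subject to `δ(B) < 1`. -/
def IsScaleFreeMinimizer {n p m : ℕ} (A : ℝ) (X : Matrix (Fin n) (Fin p) ℝ)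
    (Y : Matrix (Fin n) (Fin m) ℝ) (Bhat : Matrix (Fin p) (Fin m) ℝ) : Prop :=
  IsConstrainedMinimizer A X (fractionalForm A X Y) Bhat ∨
  IsConstrainedMinimizer A X (gcvForm A X Y) Bhat ∨
  IsConstrainedMinimizer A X (logForm A X Y) Bhat ∨
  IsConstrainedMinimizer A X (plugInForm A X Y) Bhat

/-- The entries of the random matrix `E` are i.i.d. `N(0, σ²)`. -/
def IsGaussianNoise {Ω : Type*} [MeasurableSpace Ω] (P : Measure Ω) {n m : ℕ} (σ : ℝ≥0)
    (E : Ω → Matrix (Fin n) (Fin m) ℝ) : Prop :=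
  iIndepFun (fun (ik : Fin n × Fin m) (ω : Ω) => E ω ik.1 ik.2) P ∧
    ∀ i k, HasLaw (fun ω => E ω i k) (gaussianReal 0 (σ ^ 2)) P

end ScaleFreePIC

end

/-! Write F for the noise and D = X B̂ - X B*. Comparing B̂ with B* in any of the four criteria
yields the same basic inequality (`exists_weight_of_isScaleFreeMinimizer`): (‖D‖² - 2⟨F, D⟩) w ≤
‖F‖² (2 δ(B*) - δ(B̂)/2), with a weight w bounded above and away from 0. With high probability ‖F‖²
is of order m n σ², so ‖F‖² δ(B) acts as a penalty A σ² P_o(B) although σ is unknown to the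
criterion.

It remains to bound 2⟨F, D⟩ by ‖D‖²/2 plus a multiple of σ² (P_o(B̂) + P_o(B*)); for large A the
term -δ(B̂)/2 absorbs P_o(B̂). Treating D as one matrix of rank up to r(B̂) + r(B*) would create
mixed products such as J(B̂) r(B*). `two_mul_frobInner_le` avoids them by cutting D with the
projections M and Q onto the column and row spaces of X B*: D(1 - Q) and (1 - M)DQ have the support
and rank budget of B̂ alone, and MDQ that of B* alone.

Each piece is handled by `measure_exists_frobInner_gt_le`, a net argument over factored low-rank
matrices, with a union bound over row supports paid for by the term J log(ep/J). -/

noncomputable section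

namespace ScaleFreePIC

open Matrix

/-! ### Projections, the Frobenius inner product and factorizations. -/

section LinearAlgebra

variable {n k m : ℕ}

/-- The column space of a matrix has an orthonormal basis, written as the columns of `W`. -/
theorem exists_orthonormal_columns (G : Matrix (Fin n) (Fin k) ℝ) :
    ∃ W : Matrix (Fin n) (Fin G.rank) ℝ, Wᵀ * W = 1 ∧ W * Wᵀ * G = G ∧
      ∃ R : Matrix (Fin k) (Fin G.rank) ℝ, W = G * R := by
  set K : Submodule ℝ (EuclideanSpace ℝ (Fin n)) := LinearMap.range (Matrix.toEuclideanLin G)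
    with hK
  have hfin : Module.finrank ℝ K = G.rank := by
    rw [hK, Matrix.rank_eq_finrank_range_toLin G (EuclideanSpace.basisFun (Fin n) ℝ).toBasis
      (EuclideanSpace.basisFun (Fin k) ℝ).toBasis, Matrix.toEuclideanLin_eq_toLin_orthonormal]
  let b : OrthonormalBasis (Fin G.rank) ℝ K :=
    (stdOrthonormalBasis ℝ K).reindex (finCongr hfin)
  let W : Matrix (Fin n) (Fin G.rank) ℝ := fun i j => (b j : EuclideanSpace ℝ (Fin n)) i
  have hin : ∀ x y : EuclideanSpace ℝ (Fin n), inner ℝ x y = ∑ i, x i * y i := by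
    intro x y
    simp [PiLp.inner_apply, mul_comm]
  refine ⟨W, ?_, ?_, ?_⟩
  · ext i j
    rw [Matrix.mul_apply, Matrix.one_apply]
    have := orthonormal_iff_ite.1 b.orthonormal i j
    rw [← this, Submodule.coe_inner, hin]
    rfl
  · ext i l
    have hmem : WithLp.toLp 2 (G.col l) ∈ K := by
      refine ⟨EuclideanSpace.single l 1, ?_⟩
      ext i
      simp [Matrix.toEuclideanLin, Matrix.col]
    have h1 := b.sum_repr' ⟨_, hmem⟩
    have h2 := congrArg (fun z : K => (z : EuclideanSpace ℝ (Fin n)) i) h1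
    simp only [Submodule.coe_sum, Submodule.coe_smul, Submodule.coe_inner, hin] at h2
    rw [Matrix.mul_assoc, Matrix.mul_apply]
    simp only [Matrix.mul_apply, Matrix.transpose_apply]
    simp [Matrix.col] at h2
    rw [← h2]
    exact Finset.sum_congr rfl fun j _ => mul_comm _ _
  · have hr : ∀ j, ∃ x, Matrix.toEuclideanLin G x = (b j : EuclideanSpace ℝ (Fin n)) :=
      fun j => (b j).2
    choose x hx using hr
    refine ⟨fun i j => x j i, ?_⟩
    ext i j
    have := congrArg (fun z : EuclideanSpace ℝ (Fin n) => z i) (hx j)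
    simp only [W, ← this]
    rfl

/-- The Frobenius inner product. -/
def frobInner (E M : Matrix (Fin n) (Fin m) ℝ) : ℝ := ∑ i, ∑ j, E i j * M i j

theorem frobInner_eq_trace (E M : Matrix (Fin n) (Fin m) ℝ) :
    frobInner E M = (E * Mᵀ).trace := by
  simp [frobInner, Matrix.trace, Matrix.mul_apply]

theorem frobInner_add_right (E M N : Matrix (Fin n) (Fin m) ℝ) :
    frobInner E (M + N) = frobInner E M + frobInner E N := by
  simp [frobInner, mul_add, Finset.sum_add_distrib]

theorem frobInner_smul_right (E M : Matrix (Fin n) (Fin m) ℝ) (c : ℝ) :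
    frobInner E (c • M) = c * frobInner E M := by
  simp only [frobInner, Finset.mul_sum, Matrix.smul_apply, smul_eq_mul]
  exact Finset.sum_congr rfl fun i _ => Finset.sum_congr rfl fun j _ => by ring

theorem sq_norm_eq_sum (M : Matrix (Fin n) (Fin m) ℝ) : ‖M‖ ^ 2 = ∑ i, ∑ j, M i j ^ 2 := by
  rw [Matrix.frobenius_norm_def, ← Real.sqrt_eq_rpow, Real.sq_sqrt (by positivity)]
  simp

theorem sq_norm_eq_frobInner (M : Matrix (Fin n) (Fin m) ℝ) : ‖M‖ ^ 2 = frobInner M M := by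
  rw [sq_norm_eq_sum, frobInner]
  simp only [sq]

theorem sq_norm_sub (E D : Matrix (Fin n) (Fin m) ℝ) :
    ‖E - D‖ ^ 2 = ‖E‖ ^ 2 - 2 * frobInner E D + ‖D‖ ^ 2 := by
  simp only [sq_norm_eq_sum, frobInner, Finset.mul_sum, ← Finset.sum_sub_distrib,
    ← Finset.sum_add_distrib, Matrix.sub_apply]
  exact Finset.sum_congr rfl fun i _ => Finset.sum_congr rfl fun j _ => by ring

/-- Left multiplication by an orthogonal projection matrix is contractive, and so is
multiplication by the complementary projection. -/
theorem norm_proj_mul_le {P : Matrix (Fin n) (Fin n) ℝ} (hs : Pᵀ = P) (hi : P * P = P)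
    (M : Matrix (Fin n) (Fin m) ℝ) : ‖P * M‖ ≤ ‖M‖ ∧ ‖(1 - P) * M‖ ≤ ‖M‖ := by
  have key : ‖P * M‖ ^ 2 + ‖(1 - P) * M‖ ^ 2 = ‖M‖ ^ 2 := by
    have h0 : frobInner M (P * M) = ‖P * M‖ ^ 2 := by
      rw [sq_norm_eq_frobInner, frobInner_eq_trace, frobInner_eq_trace, Matrix.transpose_mul, hs,
        ← Matrix.mul_assoc, ← Matrix.mul_assoc, Matrix.trace_mul_comm, Matrix.trace_mul_comm _ P]
      simp only [← Matrix.mul_assoc, hi]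
    have h1 : (1 - P) * M = M - P * M := by rw [Matrix.sub_mul, Matrix.one_mul]
    rw [h1, sq_norm_sub, h0]
    ring
  constructor
  · exact abs_le_of_sq_le_sq' (by nlinarith [sq_nonneg ‖(1 - P) * M‖]) (norm_nonneg _) |>.2
  · exact abs_le_of_sq_le_sq' (by nlinarith [sq_nonneg ‖P * M‖]) (norm_nonneg _) |>.2

theorem norm_mul_proj_le {Q : Matrix (Fin m) (Fin m) ℝ} (hs : Qᵀ = Q) (hi : Q * Q = Q)
    (M : Matrix (Fin n) (Fin m) ℝ) : ‖M * Q‖ ≤ ‖M‖ ∧ ‖M * (1 - Q)‖ ≤ ‖M‖ := by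
  have h := norm_proj_mul_le hs hi Mᵀ
  have e1 : (M * Q)ᵀ = Q * Mᵀ := by rw [Matrix.transpose_mul, hs]
  have e2 : (M * (1 - Q))ᵀ = (1 - Q) * Mᵀ := by
    rw [Matrix.transpose_mul, Matrix.transpose_sub, hs, Matrix.transpose_one]
  rw [← e1, ← e2] at h
  simpa only [Matrix.frobenius_norm_transpose] using h

/-- The orthogonal projection onto the column space of a matrix. -/
theorem exists_proj_columns (G : Matrix (Fin n) (Fin k) ℝ) :
    ∃ P : Matrix (Fin n) (Fin n) ℝ, Pᵀ = P ∧ P * P = P ∧ P * G = G ∧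
      ∃ R : Matrix (Fin k) (Fin n) ℝ, P = G * R := by
  obtain ⟨W, h1, h2, R, h3⟩ := exists_orthonormal_columns G
  refine ⟨W * Wᵀ, by simp, ?_, h2, R * Wᵀ, ?_⟩
  · rw [Matrix.mul_assoc, ← Matrix.mul_assoc Wᵀ, h1, Matrix.one_mul]
  · rw [← Matrix.mul_assoc, ← h3]

/-- The matrix of a linear map between Euclidean spaces. -/
def euclMatrix {s : ℕ} :
    (EuclideanSpace ℝ (Fin s) →L[ℝ] EuclideanSpace ℝ (Fin m)) →ₗ[ℝ] Matrix (Fin m) (Fin s) ℝ where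
  toFun W := Matrix.of fun i j => W (EuclideanSpace.single j 1) i
  map_add' _ _ := by ext; simp
  map_smul' _ _ := by ext; simp

/-- The operator norm acts on each row of `Z` separately. Measuring the second factor in operator
norm keeps orthonormal columns in the unit ball, where the Frobenius norm would cost √s. -/
theorem norm_mul_transpose_euclMatrix_le {s : ℕ} (Z : Matrix (Fin n) (Fin s) ℝ)
    (W : EuclideanSpace ℝ (Fin s) →L[ℝ] EuclideanSpace ℝ (Fin m)) :
    ‖Z * (euclMatrix W)ᵀ‖ ≤ ‖Z‖ * ‖W‖ := by
  refine abs_le_of_sq_le_sq' ?_ (by positivity) |>.2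
  rw [mul_pow, sq_norm_eq_sum, sq_norm_eq_sum, Finset.sum_mul]
  refine Finset.sum_le_sum fun i _ => ?_
  let z : EuclideanSpace ℝ (Fin s) := WithLp.toLp 2 (Z i)
  have hz : z = ∑ l, Z i l • EuclideanSpace.single l (1 : ℝ) := by
    ext l
    simp [z, Pi.single_apply]
  have hrow : ∀ j, (Z * (euclMatrix W)ᵀ) i j = W z j := by
    intro j
    rw [hz, map_sum, Matrix.mul_apply]
    simp [euclMatrix]
  have h1 : ∑ j, (Z * (euclMatrix W)ᵀ) i j ^ 2 = ‖W z‖ ^ 2 := by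
    rw [EuclideanSpace.norm_sq_eq]
    simp [hrow]
  have h2 : ∑ j, Z i j ^ 2 = ‖z‖ ^ 2 := by
    rw [EuclideanSpace.norm_sq_eq]
    simp [z]
  rw [h1, h2, ← mul_pow, mul_comm]
  gcongr
  exact W.le_opNorm z

theorem exists_euclMatrix_eq {s : ℕ} {W : Matrix (Fin m) (Fin s) ℝ} (hW : Wᵀ * W = 1) :
    ∃ w : EuclideanSpace ℝ (Fin s) →L[ℝ] EuclideanSpace ℝ (Fin m),
      ‖w‖ ≤ 1 ∧ euclMatrix w = W := by
  refine ⟨LinearMap.toContinuousLinearMap (Matrix.toEuclideanLin W), ?_, ?_⟩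
  · refine ContinuousLinearMap.opNorm_le_bound _ zero_le_one fun x => ?_
    refine abs_le_of_sq_le_sq' ?_ (by positivity) |>.2
    rw [one_mul, EuclideanSpace.norm_sq_eq, EuclideanSpace.norm_sq_eq]
    apply le_of_eq
    have h : (W *ᵥ x.ofLp) ⬝ᵥ (W *ᵥ x.ofLp) = x.ofLp ⬝ᵥ x.ofLp := by
      rw [Matrix.dotProduct_mulVec, ← Matrix.mulVec_transpose, Matrix.mulVec_mulVec, hW,
        Matrix.one_mulVec]
    simp only [dotProduct] at h
    simpa [sq] using h
  · ext i j
    simp [euclMatrix]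

end LinearAlgebra

/-! ### Nets of unit balls and bilinear forms. -/

section Nets

/-- The unit ball of a `d`-dimensional normed space has a `1/2`-net of at most `5 ^ d` points. -/
theorem exists_half_net (U : Type*) [NormedAddCommGroup U] [NormedSpace ℝ U]
    [FiniteDimensional ℝ U] :
    ∃ N : Finset U, N.card ≤ 5 ^ Module.finrank ℝ U ∧ (∀ x ∈ N, ‖x‖ ≤ 1) ∧
      ∀ x : U, ‖x‖ ≤ 1 → ∃ y ∈ N, ‖x - y‖ ≤ 1 / 2 := by
  classical
  let sep : Finset U → Prop := fun N =>
    (∀ x ∈ N, ‖x‖ ≤ 1) ∧ ∀ x ∈ N, ∀ y ∈ N, x ≠ y → 1 / 2 ≤ ‖x - y‖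
  have hcard : ∀ N, sep N → N.card ≤ 5 ^ Module.finrank ℝ U := by
    intro N hN
    have hinj : Function.Injective fun x : U => (2 : ℝ) • x :=
      smul_right_injective U two_ne_zero
    rw [← Finset.card_image_of_injective N hinj]
    apply Besicovitch.card_le_of_separated
    · intro c hc
      obtain ⟨x, hx, rfl⟩ := Finset.mem_image.1 hc
      simp only [norm_smul, Real.norm_ofNat]
      linarith [hN.1 x hx]
    · intro c hc d hd hcd
      obtain ⟨x, hx, rfl⟩ := Finset.mem_image.1 hc
      obtain ⟨y, hy, rfl⟩ := Finset.mem_image.1 hd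
      have hxy : x ≠ y := fun h => hcd (by rw [h])
      simp only [← smul_sub, norm_smul, Real.norm_ofNat]
      linarith [hN.2 x hx y hy hxy]
  let Q : ℕ → Prop := fun k => ∃ N, sep N ∧ N.card = k
  have hQ0 : Q 0 := ⟨∅, ⟨by simp, by simp⟩, rfl⟩
  -- A 1/2-separated set of largest cardinality is a net: an uncovered point could be added to it.
  obtain ⟨N, hN, hNc⟩ := Nat.findGreatest_spec (P := Q) (Nat.zero_le (5 ^ Module.finrank ℝ U)) hQ0
  refine ⟨N, hcard N hN, hN.1, fun x hx => ?_⟩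
  by_contra! hcon
  have hxN : x ∉ N := fun h => by
    have := hcon x h
    norm_num at this
  have hsep : sep (insert x N) := by
    refine ⟨fun y hy => ?_, fun y hy z hz hyz => ?_⟩
    · rcases Finset.mem_insert.1 hy with rfl | hy
      · exact hx
      · exact hN.1 y hy
    · rcases Finset.mem_insert.1 hy with rfl | hy' <;> rcases Finset.mem_insert.1 hz with rfl | hz'
      · exact absurd rfl hyz
      · exact (hcon z hz').le
      · rw [norm_sub_rev]
        exact (hcon y hy').le
      · exact hN.2 y hy' z hz' hyz
  have h1 : (insert x N).card = N.card + 1 := Finset.card_insert_of_notMem hxN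
  have h2 := Nat.le_findGreatest (P := Q) (hcard _ hsep) ⟨_, hsep, rfl⟩
  omega

/-- Passing to the nearest net point costs at most half the norm of the functional, so that norm is
at most τ plus half of itself. The one-sided bound suffices because the ball is symmetric. -/
theorem le_two_mul_of_net {U : Type*} [NormedAddCommGroup U] [NormedSpace ℝ U]
    [FiniteDimensional ℝ U] {N : Finset U}
    (hN : ∀ x : U, ‖x‖ ≤ 1 → ∃ y ∈ N, ‖x - y‖ ≤ 1 / 2) (f : U →ₗ[ℝ] ℝ) {τ : ℝ}
    (hf : ∀ y ∈ N, f y ≤ τ) {x : U} (hx : ‖x‖ ≤ 1) : f x ≤ 2 * τ := by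
  let F : U →L[ℝ] ℝ := LinearMap.toContinuousLinearMap f
  have hF : ∀ u, F u = f u := fun u => rfl
  have hle : ∀ u : U, ‖u‖ ≤ 1 → f u ≤ τ + ‖F‖ / 2 := by
    intro u hu
    obtain ⟨y, hy, hyu⟩ := hN u hu
    have h1 : f u = f y + f (u - y) := by rw [map_sub]; ring
    have h2 : f (u - y) ≤ ‖F‖ * ‖u - y‖ := (le_abs_self _).trans (F.le_opNorm (u - y))
    have h3 : ‖F‖ * ‖u - y‖ ≤ ‖F‖ * (1 / 2) := by gcongr
    linarith [hf y hy]
  have hτ : 0 ≤ τ + ‖F‖ / 2 := by simpa using hle 0 (by simp)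
  have hnorm : ‖F‖ ≤ τ + ‖F‖ / 2 := by
    refine ContinuousLinearMap.opNorm_le_of_unit_norm hτ fun u hu => ?_
    rw [Real.norm_eq_abs, abs_le, hF]
    constructor
    · have := hle (-u) (by rw [norm_neg, hu])
      rw [map_neg] at this
      linarith
    · exact hle u hu.le
  linarith [hle x hx]

/-- A union bound for a random bilinear form over a product of two unit balls. -/
theorem measure_exists_bilin_gt_le {Ω : Type*} [MeasurableSpace Ω] (P : Measure Ω)
    [IsFiniteMeasure P] {U V : Type*} [NormedAddCommGroup U] [NormedSpace ℝ U]
    [FiniteDimensional ℝ U] [NormedAddCommGroup V] [NormedSpace ℝ V] [FiniteDimensional ℝ V]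
    (T : Ω → U →ₗ[ℝ] V →ₗ[ℝ] ℝ) {τ β : ℝ}
    (hT : ∀ u v, ‖u‖ ≤ 1 → ‖v‖ ≤ 1 → P.real {ω | τ ≤ T ω u v} ≤ β) :
    P.real {ω | ∃ u v, ‖u‖ ≤ 1 ∧ ‖v‖ ≤ 1 ∧ 4 * τ < T ω u v}
      ≤ 5 ^ (Module.finrank ℝ U + Module.finrank ℝ V) * β := by
  obtain ⟨N₁, hc₁, hb₁, hn₁⟩ := exists_half_net U
  obtain ⟨N₂, hc₂, hb₂, hn₂⟩ := exists_half_net V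
  have hβ : 0 ≤ β := measureReal_nonneg.trans (hT 0 0 (by simp) (by simp))
  have hsub : {ω | ∃ u v, ‖u‖ ≤ 1 ∧ ‖v‖ ≤ 1 ∧ 4 * τ < T ω u v}
      ⊆ ⋃ q ∈ N₁ ×ˢ N₂, {ω | τ ≤ T ω q.1 q.2} := by
    rintro ω ⟨u, v, hu, hv, huv⟩
    by_contra hcon
    simp only [Set.mem_iUnion, not_exists, Finset.mem_product] at hcon
    have hlt : ∀ x ∈ N₁, ∀ y ∈ N₂, T ω x y ≤ τ := fun x hx y hy =>
      (not_le.1 (hcon (x, y) ⟨hx, hy⟩)).le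
    have h1 : ∀ x ∈ N₁, T ω x v ≤ 2 * τ := fun x hx =>
      le_two_mul_of_net hn₂ (T ω x) (hlt x hx) hv
    have h2 : T ω u v ≤ 2 * (2 * τ) :=
      le_two_mul_of_net hn₁ ((T ω).flip v) h1 hu
    linarith
  calc P.real {ω | ∃ u v, ‖u‖ ≤ 1 ∧ ‖v‖ ≤ 1 ∧ 4 * τ < T ω u v}
      ≤ P.real (⋃ q ∈ N₁ ×ˢ N₂, {ω | τ ≤ T ω q.1 q.2}) := measureReal_mono hsub (measure_ne_top P _)
    _ ≤ ∑ q ∈ N₁ ×ˢ N₂, P.real {ω | τ ≤ T ω q.1 q.2} := measureReal_biUnion_finset_le _ _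
    _ ≤ ∑ q ∈ N₁ ×ˢ N₂, β := by
        refine Finset.sum_le_sum fun q hq => ?_
        rw [Finset.mem_product] at hq
        exact hT _ _ (hb₁ _ hq.1) (hb₂ _ hq.2)
    _ = ((N₁.card * N₂.card : ℕ) : ℝ) * β := by
        rw [Finset.sum_const, Finset.card_product, nsmul_eq_mul]
    _ ≤ 5 ^ (Module.finrank ℝ U + Module.finrank ℝ V) * β := by
        gcongr
        rw [pow_add]
        exact_mod_cast Nat.mul_le_mul hc₁ hc₂

end Nets

/-! ### Gaussian tail bounds. -/

section Gaussian

variable {Ω : Type*} [MeasurableSpace Ω] {P : Measure Ω} {n m : ℕ} {σ : ℝ≥0}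
  {E : Ω → Matrix (Fin n) (Fin m) ℝ}

theorem hasSubgaussianMGF_of_hasLaw {X : Ω → ℝ} {v : ℝ≥0} [IsProbabilityMeasure P]
    (hX : HasLaw X (gaussianReal 0 v) P) : HasSubgaussianMGF X v P where
  integrable_exp_mul t := by
    have h := integrable_exp_mul_gaussianReal (μ := 0) (v := v) t
    rw [← hX.map_eq] at h
    exact h.comp_aemeasurable hX.aemeasurable
  mgf_le t := by
    rw [mgf_gaussianReal hX.map_eq]
    simp

/-- The Gaussian tail of the Frobenius inner product with a fixed matrix. -/
theorem measure_frobInner_ge_le [IsProbabilityMeasure P] (hσ : 0 < σ)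
    (hE : IsGaussianNoise P σ E) {M : Matrix (Fin n) (Fin m) ℝ} (hM : ‖M‖ ≤ 1) {y : ℝ}
    (hy : 0 ≤ y) :
    P.real {ω | σ * √(2 * y) ≤ frobInner (E ω) M} ≤ Real.exp (-y) := by
  have hind : iIndepFun (fun (q : Fin n × Fin m) (ω : Ω) => M q.1 q.2 * E ω q.1 q.2) P :=
    hE.1.comp (fun q x => M q.1 q.2 * x) fun q => measurable_const_mul _
  have h1 := HasSubgaussianMGF.sum_of_iIndepFun hind (s := Finset.univ)
    fun q _ => (hasSubgaussianMGF_of_hasLaw (hE.2 q.1 q.2)).const_mul (M q.1 q.2)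
  have hsum : ∀ ω, ∑ q : Fin n × Fin m, M q.1 q.2 * E ω q.1 q.2 = frobInner (E ω) M := by
    intro ω
    rw [frobInner, Fintype.sum_prod_type]
    simp only [mul_comm]
  simp only [hsum] at h1
  have h2 : HasSubgaussianMGF (fun ω => frobInner (E ω) M) (σ ^ 2) P := by
    refine ⟨h1.integrable_exp_mul, fun t => (h1.mgf_le t).trans ?_⟩
    gcongr
    rw [← NNReal.coe_le_coe, NNReal.coe_sum]
    change ∑ q : Fin n × Fin m, M q.1 q.2 ^ 2 * (σ : ℝ) ^ 2 ≤ (σ : ℝ) ^ 2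
    have hM2 : ∑ q : Fin n × Fin m, M q.1 q.2 ^ 2 = ‖M‖ ^ 2 := by
      rw [Fintype.sum_prod_type]
      exact (sq_norm_eq_sum M).symm
    rw [← Finset.sum_mul, hM2]
    refine mul_le_of_le_one_left (by positivity) ?_
    exact pow_le_one₀ (norm_nonneg _) hM
  refine (h2.measure_ge_le (by positivity)).trans_eq ?_
  have hσ' : (σ : ℝ) ≠ 0 := by exact_mod_cast hσ.ne'
  rw [mul_pow, Real.sq_sqrt (by positivity), NNReal.coe_pow]
  congr 1
  field_simp

/-- The noise is uniformly small along the matrices of low rank whose columns lie in the column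
space of a fixed matrix. -/
theorem measure_exists_frobInner_gt_le [IsProbabilityMeasure P] (hσ : 0 < σ)
    (hE : IsGaussianNoise P σ E) {k : ℕ} (G : Matrix (Fin n) (Fin k) ℝ) {t : ℝ} (ht : 0 ≤ t) :
    P.real {ω | ∃ B : Matrix (Fin k) (Fin m) ℝ,
      4 * (σ * √(2 * (3 * ((G.rank + m : ℕ) * (G * B).rank : ℝ) + t))) * ‖G * B‖
        < frobInner (E ω) (G * B)} ≤ Real.exp (-t) := by
  obtain ⟨a, ha, V, hV⟩ : ∃ a : ℕ, G.rank = a ∧ ∃ V : Matrix (Fin n) (Fin a) ℝ,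
      V * Vᵀ * G = G := by
    obtain ⟨V, -, hV, -⟩ := exists_orthonormal_columns G
    exact ⟨_, rfl, V, hV⟩
  rw [ha]
  -- The nets have at most 5^((a+m)s) ≤ e^(2(a+m)s) pairs of points. The factor 3 leaves e^(-(a+m)s)
  -- ≤ e^(-m), enough to sum over the ranks s = 1, …, m.
  let y : ℕ → ℝ := fun s => 3 * ((a + m : ℕ) * s : ℝ) + t
  have hy : ∀ s, 0 ≤ y s := fun s => by positivity
  let L : (s : ℕ) → Matrix (Fin a) (Fin s) ℝ →ₗ[ℝ] Matrix (Fin n) (Fin s) ℝ := fun s =>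
    { toFun := fun Z => V * Z
      map_add' := fun Z Z' => Matrix.mul_add _ _ _
      map_smul' := fun c Z => Matrix.mul_smul _ _ _ }
  -- A matrix of rank s factors as Z Wᵀ, which linearizes the rank constraint. Restricting Z to the
  -- column space of `G` gives dimension at most a s instead of n s.
  let T : (s : ℕ) → Ω → LinearMap.range (L s) →ₗ[ℝ]
      (EuclideanSpace ℝ (Fin s) →L[ℝ] EuclideanSpace ℝ (Fin m)) →ₗ[ℝ] ℝ := fun s ω =>
    LinearMap.mk₂ ℝ (fun Z W => frobInner (E ω) (Z.1 * (euclMatrix W)ᵀ))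
      (fun Z Z' W => by simp [Matrix.add_mul, frobInner_add_right])
      (fun c Z W => by simp [frobInner_smul_right])
      (fun Z W W' => by simp [Matrix.mul_add, frobInner_add_right])
      (fun c Z W => by simp [frobInner_smul_right])
  have hdim : ∀ s, Module.finrank ℝ (LinearMap.range (L s)) +
      Module.finrank ℝ (EuclideanSpace ℝ (Fin s) →L[ℝ] EuclideanSpace ℝ (Fin m))
        ≤ (a + m) * s := by
    intro s
    have h1 : Module.finrank ℝ (LinearMap.range (L s)) ≤ a * s := by
      refine (LinearMap.finrank_range_le (L s)).trans_eq ?_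
      simp [Module.finrank_matrix]
    have h2 : Module.finrank ℝ (EuclideanSpace ℝ (Fin s) →L[ℝ] EuclideanSpace ℝ (Fin m))
        = s * m := by
      rw [← LinearEquiv.finrank_eq (LinearMap.toContinuousLinearMap (𝕜 := ℝ)
        (E := EuclideanSpace ℝ (Fin s)) (F' := EuclideanSpace ℝ (Fin m))),
        Module.finrank_linearMap]
      simp
    rw [h2]
    nlinarith
  let bad : ℕ → Set Ω := fun s =>
    {ω | ∃ Z W, ‖Z‖ ≤ 1 ∧ ‖W‖ ≤ 1 ∧ 4 * (σ * √(2 * y s)) < T s ω Z W}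
  have hbad : ∀ s ∈ Finset.Icc 1 m, P.real (bad s) ≤ Real.exp (-(m : ℝ)) * Real.exp (-t) := by
    intro s hs
    have hs1 : 1 ≤ s := (Finset.mem_Icc.1 hs).1
    have h := measure_exists_bilin_gt_le P (T s) (τ := σ * √(2 * y s)) (β := Real.exp (-y s)) ?_
    · refine h.trans ?_
      calc (5 : ℝ) ^ _ * Real.exp (-y s) ≤ 5 ^ ((a + m) * s) * Real.exp (-y s) := by
            gcongr
            · norm_num
            · exact hdim s
        _ ≤ Real.exp 2 ^ ((a + m) * s) * Real.exp (-y s) := by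
            gcongr
            have h1 := Real.exp_one_gt_d9
            have h2 : Real.exp 2 = Real.exp 1 * Real.exp 1 := by rw [← Real.exp_add]; norm_num
            rw [h2]
            nlinarith
        _ = Real.exp (-(((a + m) * s : ℕ) : ℝ)) * Real.exp (-t) := by
            rw [← Real.exp_nat_mul, ← Real.exp_add, ← Real.exp_add]
            congr 1
            simp only [y]
            push_cast
            ring
        _ ≤ Real.exp (-(m : ℝ)) * Real.exp (-t) := by
            gcongr
            nlinarith
    · intro Z W hZ hW
      refine measure_frobInner_ge_le hσ hE ?_ (hy s)
      refine (norm_mul_transpose_euclMatrix_le Z.1 W).trans ?_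
      exact mul_le_one₀ hZ (norm_nonneg _) hW
  have hsub : {ω | ∃ B : Matrix (Fin k) (Fin m) ℝ,
      4 * (σ * √(2 * (3 * ((a + m : ℕ) * (G * B).rank : ℝ) + t))) * ‖G * B‖
        < frobInner (E ω) (G * B)} ⊆ ⋃ s ∈ Finset.Icc 1 m, bad s := by
    rintro ω ⟨B, hB⟩
    set D := G * B with hD
    have hD0 : D ≠ 0 := by
      intro h
      simp [h, frobInner] at hB
    have hnorm : 0 < ‖D‖ := norm_pos_iff.2 hD0
    obtain ⟨s, hs, W, hW1, hW2⟩ : ∃ s : ℕ, s = D.rank ∧ ∃ W : Matrix (Fin m) (Fin s) ℝ,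
        Wᵀ * W = 1 ∧ D * (W * Wᵀ) = D := by
      obtain ⟨W, hW1, hW2, -⟩ := exists_orthonormal_columns Dᵀ
      refine ⟨_, Matrix.rank_transpose D, W, hW1, ?_⟩
      simpa using congrArg Matrix.transpose hW2
    have hs1 : 1 ≤ s := by
      rw [Nat.one_le_iff_ne_zero]
      rintro rfl
      refine hD0 ?_
      rw [← hW2]
      ext i j
      simp [Matrix.mul_apply]
    have hsm : s ≤ m := hs ▸ D.rank_le_width
    obtain ⟨w, hw, hwW⟩ := exists_euclMatrix_eq hW1
    have hDW : ‖D * W‖ = ‖D‖ := by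
      rw [← sq_eq_sq₀ (norm_nonneg _) (norm_nonneg _), sq_norm_eq_frobInner, sq_norm_eq_frobInner,
        frobInner_eq_trace, frobInner_eq_trace, Matrix.transpose_mul, Matrix.mul_assoc,
        ← Matrix.mul_assoc W, ← Matrix.mul_assoc D, hW2]
    have hmem : ‖D‖⁻¹ • (D * W) ∈ LinearMap.range (L s) := by
      refine ⟨‖D‖⁻¹ • (Vᵀ * G * B * W), ?_⟩
      simp only [L, LinearMap.coe_mk, AddHom.coe_mk, Matrix.mul_smul]
      rw [← Matrix.mul_assoc, ← Matrix.mul_assoc, ← Matrix.mul_assoc, hV]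
    refine Set.mem_biUnion (Finset.mem_coe.2 (Finset.mem_Icc.2 ⟨hs1, hsm⟩)) ?_
    refine ⟨⟨_, hmem⟩, w, ?_, hw, ?_⟩
    · rw [Submodule.coe_norm, norm_smul, hDW, norm_inv, norm_norm, inv_mul_cancel₀ hnorm.ne']
    · have hT : T s ω ⟨_, hmem⟩ w = ‖D‖⁻¹ * frobInner (E ω) D := by
        simp only [T, LinearMap.mk₂_apply, hwW]
        rw [Matrix.smul_mul, frobInner_smul_right, Matrix.mul_assoc, hW2]
      rw [hT, ← div_eq_inv_mul, lt_div_iff₀ hnorm]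
      rwa [← hs] at hB
  calc P.real _ ≤ P.real (⋃ s ∈ Finset.Icc 1 m, bad s) := measureReal_mono hsub (measure_ne_top P _)
    _ ≤ ∑ s ∈ Finset.Icc 1 m, P.real (bad s) := measureReal_biUnion_finset_le _ _
    _ ≤ ∑ s ∈ Finset.Icc 1 m, Real.exp (-(m : ℝ)) * Real.exp (-t) := Finset.sum_le_sum hbad
    _ = (m * Real.exp (-(m : ℝ))) * Real.exp (-t) := by simp; ring
    _ ≤ 1 * Real.exp (-t) := by
        gcongr
        rw [Real.exp_neg, ← div_eq_mul_inv, div_le_one (Real.exp_pos _)]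
        linarith [Real.add_one_le_exp (m : ℝ)]
    _ = Real.exp (-t) := one_mul _

/-- The exponents combine to -3x²/(2v). This is the factor contributed by one noise entry in the
Chernoff bound for small ‖E‖². -/
theorem integral_exp_neg_sq_div_gaussianReal {v : ℝ≥0} (hv : v ≠ 0) :
    ∫ x, Real.exp (-(1 / (v : ℝ)) * x ^ 2) ∂gaussianReal 0 v = 1 / √3 := by
  have hv' : (0 : ℝ) < v := by positivity
  rw [integral_gaussianReal_eq_integral_smul hv]
  have h : ∀ x : ℝ, gaussianPDFReal 0 v x • Real.exp (-(1 / (v : ℝ)) * x ^ 2)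
      = (√(2 * Real.pi * v))⁻¹ * Real.exp (-(3 / (2 * v)) * x ^ 2) := by
    intro x
    rw [gaussianPDFReal, smul_eq_mul, mul_assoc, ← Real.exp_add]
    congr 2
    field_simp
    ring
  simp only [h]
  rw [integral_const_mul, integral_gaussian, ← Real.sqrt_inv, ← Real.sqrt_mul (by positivity),
    one_div, ← Real.sqrt_inv]
  congr 1
  field_simp

/-- The lower tail of the squared norm of the noise. -/
theorem measure_sq_norm_noise_le [IsProbabilityMeasure P] (hσ : 0 < σ)
    (hE : IsGaussianNoise P σ E) :
    P.real {ω | ‖E ω‖ ^ 2 ≤ (m : ℝ) * n * σ ^ 2 / 4} ≤ Real.exp (-(1 / 4) * ((m : ℝ) * n)) := by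
  have hσ' : (0 : ℝ) < σ := by exact_mod_cast hσ
  have hv : σ ^ 2 ≠ 0 := by positivity
  let X : Fin n × Fin m → Ω → ℝ := fun q ω => E ω q.1 q.2 ^ 2
  have hind : iIndepFun X P := hE.1.comp (fun _ x => x ^ 2) fun _ => by fun_prop
  have hmeas : ∀ q, AEMeasurable (X q) P := fun q => (hE.2 q.1 q.2).aemeasurable.pow_const 2
  have hsum : ∀ ω, ‖E ω‖ ^ 2 = (∑ q, X q) ω := by
    intro ω
    rw [sq_norm_eq_sum, Finset.sum_apply, Fintype.sum_prod_type]
  have ht : -(1 / (σ : ℝ) ^ 2) ≤ 0 := by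
    rw [neg_nonpos]
    positivity
  have hmgf : ∀ q, mgf (X q) P (-(1 / (σ : ℝ) ^ 2)) = 1 / √3 := by
    intro q
    rw [← integral_exp_neg_sq_div_gaussianReal hv, ← (hE.2 q.1 q.2).integral_comp, mgf]
    · simp [X]
    · fun_prop
  have hmgfsum : mgf (∑ q, X q) P (-(1 / (σ : ℝ) ^ 2)) = (1 / √3) ^ (n * m) := by
    rw [hind.mgf_sum₀ hmeas, Finset.prod_congr rfl fun q _ => hmgf q]
    simp
  have hint : Integrable (fun ω => Real.exp (-(1 / (σ : ℝ) ^ 2) * (∑ q, X q) ω)) P := by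
    refine Integrable.of_bound ?_ 1 (ae_of_all _ fun ω => ?_)
    · have : AEMeasurable (∑ q, X q) P := Finset.aemeasurable_sum _ fun q _ => hmeas q
      exact (Real.measurable_exp.comp_aemeasurable (this.const_mul _)).aestronglyMeasurable
    · rw [Real.norm_eq_abs, Real.abs_exp, Real.exp_le_one_iff, ← hsum]
      exact mul_nonpos_of_nonpos_of_nonneg ht (by positivity)
  have h := measure_le_le_exp_mul_mgf ((m : ℝ) * n * σ ^ 2 / 4) ht hint
  simp only [hsum]
  refine h.trans ?_
  have h3 : 1 / √3 ≤ Real.exp (-(1 / 2)) := by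
    rw [Real.exp_neg, ← one_div]
    refine one_div_le_one_div_of_le (Real.exp_pos _) ?_
    refine Real.le_sqrt_of_sq_le ?_
    rw [sq, ← Real.exp_add]
    norm_num
    linarith [Real.exp_one_lt_d9]
  rw [hmgfsum]
  calc _ ≤ Real.exp (-(-(1 / (σ : ℝ) ^ 2)) * ((m : ℝ) * n * σ ^ 2 / 4))
        * Real.exp (-(1 / 2)) ^ (n * m) := by gcongr
    _ = Real.exp (-(1 / 4) * ((m : ℝ) * n)) := by
        rw [← Real.exp_nat_mul, ← Real.exp_add]
        congr 1
        push_cast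
        field_simp
        ring

end Gaussian

/-! ### The complexity and the count of row supports. -/

section Complexity

variable {n p m : ℕ}

/-- The coordinate projection onto the rows in `J`. -/
def rowSelector (J : Finset (Fin p)) : Matrix (Fin p) (Fin p) ℝ :=
  Matrix.diagonal fun i => if i ∈ J then 1 else 0

theorem rank_rowSelector (J : Finset (Fin p)) : (rowSelector J).rank = J.card := by
  rw [rowSelector, Matrix.rank_diagonal]
  simp

theorem rowSelector_mul (B : Matrix (Fin p) (Fin m) ℝ) :
    rowSelector (rowSupport B) * B = B := by
  ext i j
  rw [rowSelector, Matrix.diagonal_mul]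
  by_cases h : i ∈ rowSupport B
  · simp [h]
  · have h0 : B.row i = 0 := by simpa [rowSupport] using h
    have : B i j = 0 := congrFun h0 j
    simp [this]

theorem rank_le_numRows (B : Matrix (Fin p) (Fin m) ℝ) : B.rank ≤ numRows B := by
  calc B.rank = (rowSelector (rowSupport B) * B).rank := by rw [rowSelector_mul]
    _ ≤ (rowSelector (rowSupport B)).rank := Matrix.rank_mul_le_left _ _
    _ = numRows B := rank_rowSelector _

theorem numRows_le (B : Matrix (Fin p) (Fin m) ℝ) : numRows B ≤ p := by
  simpa [numRows] using Finset.card_le_univ (rowSupport B)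

theorem numRows_eq_zero_iff {B : Matrix (Fin p) (Fin m) ℝ} : numRows B = 0 ↔ B = 0 := by
  constructor
  · intro h
    rw [← rowSelector_mul B, Finset.card_eq_zero.1 h]
    simp [rowSelector]
  · rintro rfl
    refine Finset.card_eq_zero.2 (Finset.filter_eq_empty_iff.2 fun j _ => ?_)
    simp only [not_not]
    rfl

/-- The sparsity part `J log (e p / J)` of the complexity. -/
def sparsityTerm (p k : ℕ) : ℝ := (k : ℝ) * Real.log (Real.exp 1 * p / k)

/-- The difference of the two sides is (k - 1)(log p - log k) + (k - 1 - log k), with both summands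
nonnegative. -/
theorem one_add_log_le_sparsityTerm {k : ℕ} (hk : 1 ≤ k) (hkp : k ≤ p) :
    1 + Real.log p ≤ sparsityTerm p k := by
  have hk0 : (0 : ℝ) < k := by exact_mod_cast hk
  have hp0 : (0 : ℝ) < p := by exact_mod_cast Nat.le_trans hk hkp
  have hlog : Real.log k ≤ Real.log p := Real.log_le_log hk0 (by exact_mod_cast hkp)
  have hk1 : Real.log k ≤ k - 1 := Real.log_le_sub_one_of_pos hk0
  have hk2 : (1 : ℝ) ≤ k := by exact_mod_cast hk
  rw [sparsityTerm, Real.log_div (by positivity) hk0.ne',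
    Real.log_mul (Real.exp_ne_zero _) hp0.ne', Real.log_exp]
  nlinarith [mul_nonneg (sub_nonneg.2 hk2) (sub_nonneg.2 hlog)]

theorem sparsityTerm_nonneg {k : ℕ} (hkp : k ≤ p) : 0 ≤ sparsityTerm p k := by
  rcases Nat.eq_zero_or_pos k with rfl | hk
  · simp [sparsityTerm]
  · have h : (1 : ℝ) ≤ p := by exact_mod_cast Nat.le_trans hk hkp
    linarith [one_add_log_le_sparsityTerm hk hkp, Real.log_nonneg h]

theorem choose_le_exp_sparsityTerm {k : ℕ} (hk : 1 ≤ k) (hkp : k ≤ p) :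
    (p.choose k : ℝ) ≤ Real.exp (sparsityTerm p k) := by
  have hk0 : (0 : ℝ) < k := by exact_mod_cast hk
  have hp0 : (0 : ℝ) < p := by exact_mod_cast Nat.le_trans hk hkp
  have h1 : (k : ℝ) ^ k / k.factorial ≤ Real.exp k := Real.pow_div_factorial_le_exp k hk0.le k
  have h2 : Real.exp (sparsityTerm p k) = Real.exp k * (p / k : ℝ) ^ k := by
    rw [sparsityTerm, Real.exp_nat_mul, Real.exp_log (by positivity), mul_div_assoc, mul_pow,
      ← Real.exp_nat_mul, mul_one]
  calc (p.choose k : ℝ) ≤ (p : ℝ) ^ k / k.factorial := Nat.choose_le_pow_div k p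
    _ = (k : ℝ) ^ k / k.factorial * (p / k : ℝ) ^ k := by
        rw [div_pow]
        field_simp
    _ ≤ Real.exp (sparsityTerm p k) := by
        rw [h2]
        gcongr

/-- One of the three copies of the sparsity term pays for the binomial coefficient; the other two
leave at most p⁻² for each of the p sizes. -/
theorem sum_exp_neg_sparsityTerm_le :
    ∑ J ∈ (Finset.univ : Finset (Finset (Fin p))).erase ∅, Real.exp (-(3 * sparsityTerm p J.card))
      ≤ (p : ℝ)⁻¹ := by
  let f : ℕ → ℝ := fun k => if k = 0 then 0 else Real.exp (-(3 * sparsityTerm p k))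
  have h1 : ∑ J ∈ (Finset.univ : Finset (Finset (Fin p))).erase ∅,
      Real.exp (-(3 * sparsityTerm p J.card)) = ∑ J : Finset (Fin p), f J.card := by
    rw [← Finset.sum_erase_add _ _ (Finset.mem_univ (∅ : Finset (Fin p)))]
    simp only [f, Finset.card_empty, if_true, add_zero]
    refine Finset.sum_congr rfl fun J hJ => ?_
    rw [if_neg]
    simpa using hJ
  have h2 := Finset.sum_powerset_apply_card f (x := (Finset.univ : Finset (Fin p)))
  rw [Finset.powerset_univ, Finset.card_univ, Fintype.card_fin] at h2
  rw [h1, h2]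
  rcases Nat.eq_zero_or_pos p with rfl | hp
  · simp [f]
  have hp0 : (0 : ℝ) < p := by exact_mod_cast hp
  rw [Finset.sum_range_succ']
  simp only [f, if_true, smul_zero, add_zero]
  calc _ ≤ ∑ k ∈ Finset.range p, ((p : ℝ) ^ 2)⁻¹ := by
        refine Finset.sum_le_sum fun k hk => ?_
        have hk1 : k + 1 ≤ p := Finset.mem_range.1 hk
        rw [if_neg (Nat.succ_ne_zero k), nsmul_eq_mul]
        have hs := one_add_log_le_sparsityTerm (Nat.le_add_left 1 k) hk1
        calc (p.choose (k + 1) : ℝ) * Real.exp (-(3 * sparsityTerm p (k + 1)))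
            ≤ Real.exp (sparsityTerm p (k + 1)) * Real.exp (-(3 * sparsityTerm p (k + 1))) := by
              gcongr
              exact choose_le_exp_sparsityTerm (Nat.le_add_left 1 k) hk1
          _ = Real.exp (-(2 * sparsityTerm p (k + 1))) := by
              rw [← Real.exp_add]
              ring_nf
          _ ≤ Real.exp (-(2 * Real.log p)) := by
              gcongr
              linarith
          _ = ((p : ℝ) ^ 2)⁻¹ := by
              rw [Real.exp_neg, ← Nat.cast_ofNat (R := ℝ), Real.exp_nat_mul, Real.exp_log hp0]
    _ = (p : ℝ)⁻¹ := by
        rw [Finset.sum_const, Finset.card_range, nsmul_eq_mul]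
        field_simp

theorem complexity_eq (X : Matrix (Fin n) (Fin p) ℝ) (B : Matrix (Fin p) (Fin m) ℝ) :
    complexity X B = ((min X.rank (numRows B) : ℕ) + (m : ℝ) - (B.rank : ℝ)) * (B.rank : ℝ)
      + sparsityTerm p (numRows B) := rfl

/-- Links the dimension count of the noise bound to the complexity. Let a = min(q, J) and r = rank
B. If r ≤ a, then a + m - r ≥ (a + m)/2. Otherwise (a + m - r) r - a m = (r - a)(m - r) ≥ 0, while
rank (X B) is at most both a and m. -/
theorem rank_mul_le_complexity (X : Matrix (Fin n) (Fin p) ℝ) (B : Matrix (Fin p) (Fin m) ℝ) :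
    ((min X.rank (numRows B) + m : ℕ) * (X * B).rank : ℝ) + 2 * sparsityTerm p (numRows B)
      ≤ 2 * complexity X B := by
  rw [complexity_eq]
  have h1 : (X * B).rank ≤ X.rank := Matrix.rank_mul_le_left _ _
  have h2 : (X * B).rank ≤ B.rank := Matrix.rank_mul_le_right _ _
  have h3 := rank_le_numRows B
  have h4 : B.rank ≤ m := B.rank_le_width
  generalize (X * B).rank = s at *
  generalize B.rank = r at *
  generalize numRows B = J at *
  obtain ⟨a, ha⟩ : ∃ a, a = min X.rank J := ⟨_, rfl⟩
  have hsa : s ≤ a := by omega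
  rw [← ha]
  have h2' : (s : ℝ) ≤ r := by exact_mod_cast h2
  have h4' : (r : ℝ) ≤ m := by exact_mod_cast h4
  have hsa' : (s : ℝ) ≤ a := by exact_mod_cast hsa
  have hs0 : (0 : ℝ) ≤ s := by positivity
  push_cast
  rcases le_total r a with hra | hra
  · have hra' : (r : ℝ) ≤ a := by exact_mod_cast hra
    nlinarith [mul_nonneg (sub_nonneg.2 hra') (hs0.trans h2'),
      mul_nonneg (sub_nonneg.2 h4') (hs0.trans h2'),
      mul_nonneg (sub_nonneg.2 h2') (by positivity : (0 : ℝ) ≤ a + m)]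
  · have hra' : (a : ℝ) ≤ r := by exact_mod_cast hra
    nlinarith [mul_nonneg (sub_nonneg.2 hra') (sub_nonneg.2 h4'),
      mul_nonneg (sub_nonneg.2 hsa') (by positivity : (0 : ℝ) ≤ m),
      mul_nonneg (sub_nonneg.2 (h2'.trans h4')) (by positivity : (0 : ℝ) ≤ a)]

theorem sparsityTerm_le_complexity (X : Matrix (Fin n) (Fin p) ℝ)
    (B : Matrix (Fin p) (Fin m) ℝ) : sparsityTerm p (numRows B) ≤ complexity X B := by
  have h := rank_mul_le_complexity X B
  have h0 : (0 : ℝ) ≤ ((min X.rank (numRows B) + m : ℕ) * (X * B).rank : ℝ) := by positivity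
  linarith

theorem complexity_nonneg (X : Matrix (Fin n) (Fin p) ℝ) (B : Matrix (Fin p) (Fin m) ℝ) :
    0 ≤ complexity X B :=
  (sparsityTerm_nonneg (numRows_le B)).trans (sparsityTerm_le_complexity X B)

end Complexity

/-! ### Uniform noise bounds over row supports. -/

section NoiseEvents

variable {Ω : Type*} [MeasurableSpace Ω] {P : Measure Ω} {n p m : ℕ} {σ : ℝ≥0}
  {E : Ω → Matrix (Fin n) (Fin m) ℝ}

/-- The bound for the inner product with the noise, at dimension `a`, for a matrix `D`. -/
def NoiseBound (σ : ℝ≥0) (E : Matrix (Fin n) (Fin m) ℝ) (a : ℕ) (t : ℝ)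
    (D : Matrix (Fin n) (Fin m) ℝ) : Prop :=
  frobInner E D ≤ 4 * (σ * √(2 * (3 * ((a + m : ℕ) * D.rank : ℝ) + t))) * ‖D‖

theorem NoiseBound.mono {F : Matrix (Fin n) (Fin m) ℝ} {a b : ℕ} (hab : a ≤ b) {t : ℝ}
    {D : Matrix (Fin n) (Fin m) ℝ} (h : NoiseBound σ F a t D) : NoiseBound σ F b t D := by
  have hab' : ((a + m : ℕ) : ℝ) ≤ (b + m : ℕ) := by exact_mod_cast Nat.add_le_add_right hab m
  refine le_trans h (mul_le_mul_of_nonneg_right ?_ (norm_nonneg D))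
  refine mul_le_mul_of_nonneg_left ?_ (by norm_num)
  refine mul_le_mul_of_nonneg_left (Real.sqrt_le_sqrt ?_) σ.2
  have := mul_le_mul_of_nonneg_right hab' (Nat.cast_nonneg (α := ℝ) D.rank)
  linarith

theorem measure_not_noiseBound_le [IsProbabilityMeasure P] (hσ : 0 < σ)
    (hE : IsGaussianNoise P σ E) {k : ℕ} (G : Matrix (Fin n) (Fin k) ℝ) {t : ℝ} (ht : 0 ≤ t) :
    P.real {ω | ¬ ∀ B : Matrix (Fin k) (Fin m) ℝ, NoiseBound σ (E ω) G.rank t (G * B)}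
      ≤ Real.exp (-t) := by
  simpa only [NoiseBound, not_forall, not_le] using measure_exists_frobInner_gt_le hσ hE G ht

/-- The noise is uniformly small along all row-sparse coefficient matrices of low rank. -/
theorem measure_not_sparse_noiseBound_le [IsProbabilityMeasure P] (hσ : 0 < σ)
    (hE : IsGaussianNoise P σ E) (X : Matrix (Fin n) (Fin p) ℝ) :
    P.real {ω | ¬ ∀ (J : Finset (Fin p)) (C : Matrix (Fin p) (Fin m) ℝ),
      NoiseBound σ (E ω) (min X.rank J.card) (3 * sparsityTerm p J.card)
        (X * (rowSelector J * C))} ≤ (p : ℝ)⁻¹ := by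
  have hcard : ∀ J : Finset (Fin p), J.card ≤ p := fun J => by simpa using Finset.card_le_univ J
  have hrank : ∀ J : Finset (Fin p), (X * rowSelector J).rank ≤ min X.rank J.card := fun J =>
    le_min (Matrix.rank_mul_le_left _ _)
      ((Matrix.rank_mul_le_right _ _).trans_eq (rank_rowSelector J))
  have hbad : ∀ J : Finset (Fin p), P.real {ω | ¬ ∀ C : Matrix (Fin p) (Fin m) ℝ,
      NoiseBound σ (E ω) (min X.rank J.card) (3 * sparsityTerm p J.card)
        (X * (rowSelector J * C))} ≤ Real.exp (-(3 * sparsityTerm p J.card)) := by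
    intro J
    refine le_trans (measureReal_mono ?_ (measure_ne_top P _)) (measure_not_noiseBound_le hσ hE
      (X * rowSelector J) (mul_nonneg (by norm_num) (sparsityTerm_nonneg (hcard J))))
    intro ω hω hcon
    refine hω fun C => ?_
    rw [← Matrix.mul_assoc]
    exact (hcon C).mono (hrank J)
  refine le_trans ?_ sum_exp_neg_sparsityTerm_le
  refine le_trans ?_ (Finset.sum_le_sum fun J _ => hbad J)
  refine le_trans (measureReal_mono ?_ (measure_ne_top P _)) (measureReal_biUnion_finset_le _ _)
  intro ω hω
  by_contra hcon
  refine hω fun J C => ?_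
  rcases eq_or_ne J ∅ with rfl | hJ
  · have h0 : X * (rowSelector (∅ : Finset (Fin p)) * C) = 0 := by
      have h1 : rowSelector (∅ : Finset (Fin p)) = 0 := by simp [rowSelector]
      rw [h1, Matrix.zero_mul, Matrix.mul_zero]
    rw [h0]
    simp [NoiseBound, frobInner]
  · simp only [Set.mem_iUnion, not_exists] at hcon
    exact not_not.1 (hcon J (by simpa using hJ)) C

end NoiseEvents

/-! ### Deterministic inequalities on the good event. -/

section Deterministic

variable {n p m : ℕ} {σ : ℝ≥0} {F : Matrix (Fin n) (Fin m) ℝ}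

/-- Young's inequality; the weight 1/8 lets three pieces of D use at most half of ‖D‖². -/
theorem NoiseBound.two_mul_le {a : ℕ} {t : ℝ} {D : Matrix (Fin n) (Fin m) ℝ}
    (h : NoiseBound σ F a t D) {c d : ℝ} (hc : 3 * ((a + m : ℕ) * D.rank : ℝ) + t ≤ 6 * c)
    (hc0 : 0 ≤ c) (hd : ‖D‖ ≤ d) :
    2 * frobInner F D ≤ d ^ 2 / 8 + 1536 * (σ ^ 2 * c) := by
  have hd0 : 0 ≤ d := (norm_nonneg _).trans hd
  have h1 : frobInner F D ≤ 4 * (σ * √(12 * c)) * d := by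
    refine le_trans h (mul_le_mul ?_ hd (norm_nonneg _) (by positivity))
    refine mul_le_mul_of_nonneg_left ?_ (by norm_num)
    refine mul_le_mul_of_nonneg_left (Real.sqrt_le_sqrt ?_) σ.2
    linarith
  have h2 : √(12 * c) ^ 2 = 12 * c := Real.sq_sqrt (by positivity)
  have h3 : (σ * √(12 * c)) ^ 2 = 12 * (σ ^ 2 * c) := by
    rw [mul_pow, h2]
    ring
  nlinarith [sq_nonneg (d - 32 * (σ * √(12 * c)))]

/-- On the noise events, the cross term is controlled by the complexities. -/
theorem two_mul_frobInner_le {X : Matrix (Fin n) (Fin p) ℝ} {Bstar : Matrix (Fin p) (Fin m) ℝ}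
    {M : Matrix (Fin n) (Fin n) ℝ} (hMs : Mᵀ = M) (hMi : M * M = M)
    (hMX : M * (X * Bstar) = X * Bstar) {R : Matrix (Fin m) (Fin n) ℝ} (hMR : M = X * Bstar * R)
    (h1 : ∀ (J : Finset (Fin p)) (C : Matrix (Fin p) (Fin m) ℝ),
      NoiseBound σ F (min X.rank J.card) (3 * sparsityTerm p J.card) (X * (rowSelector J * C)))
    (h2 : ∀ (J : Finset (Fin p)) (C : Matrix (Fin p) (Fin m) ℝ),
      NoiseBound σ F (min ((1 - M) * X).rank J.card) (3 * sparsityTerm p J.card)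
        ((1 - M) * X * (rowSelector J * C)))
    (h3 : ∀ C : Matrix (Fin m) (Fin m) ℝ,
      NoiseBound σ F (X * Bstar).rank (Real.log p) (X * Bstar * C))
    (B : Matrix (Fin p) (Fin m) ℝ) :
    2 * frobInner F (X * B - X * Bstar) ≤ ‖X * B - X * Bstar‖ ^ 2 / 2
      + 3072 * (σ ^ 2 * (complexity X B + complexity X Bstar)) := by
  obtain ⟨Q, hQs, hQi, hQ, -⟩ := exists_proj_columns (X * Bstar)ᵀ
  have hXQ : X * Bstar * Q = X * Bstar := by
    have := congrArg Matrix.transpose hQ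
    rwa [Matrix.transpose_mul, Matrix.transpose_transpose, hQs] at this
  set D := X * B - X * Bstar with hD
  set J := rowSupport B with hJ
  have hJc : J.card = numRows B := rfl
  have hcB := complexity_nonneg X B
  have hcS := complexity_nonneg X Bstar
  have e1 : D * (1 - Q) = X * (rowSelector J * (B * (1 - Q))) := by
    rw [← Matrix.mul_assoc _ B, hJ, rowSelector_mul, hD, Matrix.sub_mul,
      Matrix.mul_sub (X * Bstar), hXQ, Matrix.mul_one, sub_self, sub_zero, Matrix.mul_assoc]
  have e2 : (1 - M) * (D * Q) = (1 - M) * X * (rowSelector J * (B * Q)) := by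
    have h0 : (1 - M) * (X * Bstar) = 0 := by
      rw [Matrix.sub_mul, hMX, Matrix.one_mul, sub_self]
    rw [← Matrix.mul_assoc _ B, hJ, rowSelector_mul, hD, Matrix.sub_mul (X * B), hXQ,
      Matrix.mul_sub, h0, sub_zero]
    simp only [Matrix.mul_assoc]
  have e3 : M * (D * Q) = X * Bstar * (R * (D * Q)) := by
    rw [← Matrix.mul_assoc (X * Bstar), ← hMR]
  have hdec : D = D * (1 - Q) + (1 - M) * (D * Q) + M * (D * Q) := by
    rw [Matrix.mul_sub D, Matrix.sub_mul 1 M, Matrix.mul_one, Matrix.one_mul]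
    abel
  have hDQ : ‖D * Q‖ ≤ ‖D‖ := (norm_mul_proj_le hQs hQi D).1
  have hr1 : (X * (rowSelector J * (B * (1 - Q)))).rank ≤ (X * B).rank := by
    rw [← Matrix.mul_assoc _ B, hJ, rowSelector_mul, ← Matrix.mul_assoc]
    exact Matrix.rank_mul_le_left _ _
  have hr2 : ((1 - M) * X * (rowSelector J * (B * Q))).rank ≤ (X * B).rank := by
    rw [← Matrix.mul_assoc _ B, hJ, rowSelector_mul, Matrix.mul_assoc, ← Matrix.mul_assoc X]
    exact (Matrix.rank_mul_le_right _ _).trans (Matrix.rank_mul_le_left _ _)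
  have hB := rank_mul_le_complexity X B
  have hS := rank_mul_le_complexity X Bstar
  have hsp := sparsityTerm_nonneg (numRows_le B)
  have hcomp : ∀ s : ℕ, s ≤ (X * B).rank →
      3 * ((min X.rank J.card + m : ℕ) * s : ℝ) + 3 * sparsityTerm p J.card
        ≤ 6 * complexity X B := by
    intro s hs
    have hs' : (s : ℝ) ≤ (X * B).rank := by exact_mod_cast hs
    have := mul_le_mul_of_nonneg_left hs'
      (Nat.cast_nonneg (α := ℝ) (min X.rank (numRows B) + m))
    rw [hJc]
    linarith
  have i1 := (h1 J (B * (1 - Q))).two_mul_le (hcomp _ hr1) hcB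
    (e1 ▸ (norm_mul_proj_le hQs hQi D).2)
  have i2 := ((h2 J (B * Q)).mono
    (min_le_min_right _ (Matrix.rank_mul_le_right _ _))).two_mul_le (hcomp _ hr2) hcB
    (e2 ▸ (norm_proj_mul_le hMs hMi (D * Q)).2.trans hDQ)
  have i3 : 2 * frobInner F (M * (D * Q)) ≤ ‖D‖ ^ 2 / 8 + 1536 * (σ ^ 2 * complexity X Bstar) := by
    -- The deviation level log p is dominated by the sparsity term of `Bstar` only if that matrix
    -- has a nonzero row.
    rcases eq_or_ne Bstar 0 with h0 | h0
    · have hM0 : M = 0 := by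
        rw [hMR, h0, Matrix.mul_zero, Matrix.zero_mul]
      have hz : frobInner F (M * (D * Q)) = 0 := by
        rw [hM0, Matrix.zero_mul]
        simp [frobInner]
      rw [hz, mul_zero]
      positivity
    · rw [e3]
      refine (h3 (R * (D * Q))).two_mul_le ?_ hcS
        (e3 ▸ (norm_proj_mul_le hMs hMi (D * Q)).1.trans hDQ)
      have hJ1 : 1 ≤ numRows Bstar :=
        Nat.one_le_iff_ne_zero.2 fun h => h0 (numRows_eq_zero_iff.1 h)
      have hlog := one_add_log_le_sparsityTerm hJ1 (numRows_le Bstar)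
      have hlp : 0 ≤ sparsityTerm p (numRows Bstar) := sparsityTerm_nonneg (numRows_le Bstar)
      have ha : (X * Bstar).rank ≤ min X.rank (numRows Bstar) :=
        le_min (Matrix.rank_mul_le_left _ _)
          ((Matrix.rank_mul_le_right _ _).trans (rank_le_numRows Bstar))
      have hb : (X * Bstar * (R * (D * Q))).rank ≤ (X * Bstar).rank :=
        Matrix.rank_mul_le_left _ _
      have hab : (((X * Bstar).rank + m : ℕ) * (X * Bstar * (R * (D * Q))).rank : ℝ)
          ≤ (min X.rank (numRows Bstar) + m : ℕ) * (X * Bstar).rank := by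
        exact_mod_cast Nat.mul_le_mul (Nat.add_le_add_right ha m) hb
      linarith
  have hsum : frobInner F D = frobInner F (D * (1 - Q)) + frobInner F ((1 - M) * (D * Q))
      + frobInner F (M * (D * Q)) := by
    rw [← frobInner_add_right, ← frobInner_add_right, ← hdec]
  rw [← e1] at i1
  rw [← e2] at i2
  have hpos : 0 ≤ (σ : ℝ) ^ 2 * complexity X Bstar := by positivity
  rw [hsum]
  nlinarith [sq_nonneg ‖D‖]

/-- Testing the noise against itself turns the bound into ‖F‖² ≤ c‖F‖, and 224 = 4² · 14. -/
theorem sq_norm_le_of_noiseBound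
    (h : ∀ C : Matrix (Fin n) (Fin m) ℝ,
      NoiseBound σ F (1 : Matrix (Fin n) (Fin n) ℝ).rank ((m : ℝ) * n)
        ((1 : Matrix (Fin n) (Fin n) ℝ) * C)) :
    ‖F‖ ^ 2 ≤ 224 * ((m : ℝ) * n * σ ^ 2) := by
  have h1 := h F
  rw [Matrix.one_mul, NoiseBound, ← sq_norm_eq_frobInner, Matrix.rank_one, Fintype.card_fin] at h1
  have hr : (((n + m : ℕ) : ℝ) * F.rank) ≤ 2 * (m * n) := by
    have h2 : F.rank ≤ n := F.rank_le_height
    have h3 : F.rank ≤ m := F.rank_le_width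
    have : (n + m) * F.rank ≤ 2 * (m * n) := by nlinarith
    exact_mod_cast this
  have h2 : ‖F‖ ^ 2 ≤ 4 * (σ * √(14 * (m * n))) * ‖F‖ := by
    refine h1.trans (mul_le_mul_of_nonneg_right ?_ (norm_nonneg _))
    refine mul_le_mul_of_nonneg_left ?_ (by norm_num)
    refine mul_le_mul_of_nonneg_left (Real.sqrt_le_sqrt ?_) σ.2
    linarith
  have h3 : (σ * √(14 * (m * n))) ^ 2 = 14 * ((m : ℝ) * n * σ ^ 2) := by
    rw [mul_pow, Real.sq_sqrt (by positivity)]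
    ring
  nlinarith [sq_nonneg (‖F‖ - 4 * (σ * √(14 * (m * n))))]

/-- Brings the logarithmic criterion to the linear form of the other three. The factors 2 and 1/2
come from e^x - 1 ≤ 2x and e^(-x) - 1 ≤ -x/2 on [0, 1]. -/
theorem exp_sub_sub_one_le {u v : ℝ} (hu0 : 0 ≤ u) (hu1 : u < 1) (hv0 : 0 ≤ v) (hv1 : v < 1) :
    Real.exp (u - v) - 1 ≤ 2 * u - v / 2 := by
  rcases le_total v u with h | h
  · have h1 := (abs_le.1 (Real.abs_exp_sub_one_sub_id_le (x := u - v)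
      (by rw [abs_of_nonneg (by linarith)]; linarith))).2
    nlinarith
  · have h1 : Real.exp (u - v) ≤ 1 / (1 + (v - u)) := by
      rw [show u - v = -(v - u) by ring, Real.exp_neg, ← one_div]
      refine one_div_le_one_div_of_le (by linarith) ?_
      linarith [Real.add_one_le_exp (v - u)]
    have h2 : 1 / (1 + (v - u)) ≤ 1 - (v - u) / 2 := by
      rw [div_le_iff₀ (by linarith)]
      nlinarith
    linarith

/-- The basic inequality shared by the four scale-free criteria. -/
theorem exists_weight_of_isScaleFreeMinimizer {A w₀ : ℝ} (hA : 0 ≤ A)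
    {X : Matrix (Fin n) (Fin p) ℝ} {Bstar Bhat : Matrix (Fin p) (Fin m) ℝ}
    (hw₀ : 0 < w₀) (hδ : scaledComplexity A X Bstar ≤ 1 - w₀) (hw₁ : w₀ ≤ 1) (hF : F ≠ 0)
    (h : IsScaleFreeMinimizer A X (X * Bstar + F) Bhat) :
    ∃ w, w₀ ^ 2 ≤ w ∧ w ≤ 2 ∧
      (‖X * Bhat - X * Bstar‖ ^ 2 - 2 * frobInner F (X * Bhat - X * Bstar)) * w
        ≤ ‖F‖ ^ 2 * (2 * scaledComplexity A X Bstar - scaledComplexity A X Bhat / 2) := by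
  have hnonneg : ∀ B : Matrix (Fin p) (Fin m) ℝ, 0 ≤ scaledComplexity A X B := fun B =>
    div_nonneg (mul_nonneg hA (complexity_nonneg X B)) (by positivity)
  have hstar : rss X (X * Bstar + F) Bstar = ‖F‖ ^ 2 := by
    rw [rss, add_sub_cancel_left]
  have hhat : rss X (X * Bstar + F) Bhat = ‖F‖ ^ 2
      - 2 * frobInner F (X * Bhat - X * Bstar) + ‖X * Bhat - X * Bstar‖ ^ 2 := by
    rw [rss, ← sq_norm_sub]
    congr 2
    abel
  have hb0 : 0 ≤ rss X (X * Bstar + F) Bhat := sq_nonneg _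
  have ha : 0 < ‖F‖ ^ 2 := by
    have := norm_pos_iff.2 hF
    positivity
  have hu0 := hnonneg Bstar
  have hv0 := hnonneg Bhat
  have hd : ‖X * Bhat - X * Bstar‖ ^ 2 - 2 * frobInner F (X * Bhat - X * Bstar)
      = rss X (X * Bstar + F) Bhat - ‖F‖ ^ 2 := by
    rw [hhat]
    ring
  rw [hd]
  have hmem : Bstar ∈ {B | scaledComplexity A X B < 1} := by
    simp only [Set.mem_ofPred_eq]
    linarith
  rcases h with ⟨hv1, h⟩ | ⟨hv1, h⟩ | ⟨hv1, h⟩ | ⟨hv1, h⟩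
  · have hm := isMinOn_iff.1 h _ hmem
    simp only [fractionalForm, hstar] at hm
    generalize scaledComplexity A X Bstar = u at *
    generalize scaledComplexity A X Bhat = v at *
    rw [div_le_div_iff₀ (by linarith) (by linarith)] at hm
    exact ⟨1 - u, by nlinarith, by linarith, by nlinarith⟩
  · have hm := isMinOn_iff.1 h _ hmem
    simp only [gcvForm, hstar] at hm
    generalize scaledComplexity A X Bstar = u at *
    generalize scaledComplexity A X Bhat = v at *
    have h1 : 0 < 1 - u := by linarith
    have h2 : 0 < 1 - v := by linarith
    rw [div_le_div_iff₀ (by positivity) (by positivity)] at hm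
    refine ⟨(1 - u) ^ 2, by nlinarith, by nlinarith, ?_⟩
    have h3 : (1 - v) ^ 2 - (1 - u) ^ 2 ≤ 2 * u - v / 2 := by nlinarith
    nlinarith [mul_le_mul_of_nonneg_left h3 ha.le]
  · have hm := isMinOn_iff.1 h _ hmem
    simp only [logForm, hstar] at hm
    generalize scaledComplexity A X Bstar = u at *
    generalize scaledComplexity A X Bhat = v at *
    refine ⟨1, by nlinarith, by norm_num, ?_⟩
    have hle : rss X (X * Bstar + F) Bhat ≤ ‖F‖ ^ 2 * Real.exp (u - v) := by
      rcases hb0.eq_or_lt with h0 | h0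
      · rw [← h0]
        positivity
      · rw [ENNReal.log_ofReal_of_pos h0, ENNReal.log_ofReal_of_pos ha, ← EReal.coe_add,
          ← EReal.coe_add, EReal.coe_le_coe_iff] at hm
        rw [← Real.log_le_log_iff h0 (by positivity),
          Real.log_mul ha.ne' (Real.exp_ne_zero _), Real.log_exp]
        linarith
    have he := exp_sub_sub_one_le hu0 (by linarith) hv0 hv1
    nlinarith [mul_le_mul_of_nonneg_left he ha.le]
  · have hm := isMinOn_iff.1 h _ hmem
    simp only [plugInForm, hstar] at hm
    generalize scaledComplexity A X Bstar = u at *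
    generalize scaledComplexity A X Bhat = v at *
    exact ⟨1 + v, by nlinarith, by linarith, by nlinarith⟩

/-- The oracle inequality on the event where the noise is well behaved. -/
theorem sq_norm_le_of_isScaleFreeMinimizer {A w₀ : ℝ} (hA : 50000 ≤ A)
    {X : Matrix (Fin n) (Fin p) ℝ} {Bstar Bhat : Matrix (Fin p) (Fin m) ℝ}
    (hσ : 0 < σ) (hmn : (0 : ℝ) < (m : ℝ) * n)
    (hw₀ : 0 < w₀) (hδ : scaledComplexity A X Bstar ≤ 1 - w₀) (hw₁ : w₀ ≤ 1)
    (hlow : (m : ℝ) * n * σ ^ 2 / 4 < ‖F‖ ^ 2) (hup : ‖F‖ ^ 2 ≤ 224 * ((m : ℝ) * n * σ ^ 2))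
    (hcross : 2 * frobInner F (X * Bhat - X * Bstar) ≤ ‖X * Bhat - X * Bstar‖ ^ 2 / 2
      + 3072 * (σ ^ 2 * (complexity X Bhat + complexity X Bstar)))
    (h : IsScaleFreeMinimizer A X (X * Bstar + F) Bhat) :
    ‖X * Bhat - X * Bstar‖ ^ 2
      ≤ 2 * (6144 + 448 * A) / w₀ ^ 2 * (σ ^ 2 * complexity X Bstar) := by
  have hσ' : (0 : ℝ) < σ := by exact_mod_cast hσ
  have hF : F ≠ 0 := by
    rintro rfl
    have : (0 : ℝ) < (m : ℝ) * n * σ ^ 2 := by positivity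
    simp at hlow
    linarith
  obtain ⟨w, hw, hw2, hle⟩ :=
    exists_weight_of_isScaleFreeMinimizer (by linarith) hw₀ hδ hw₁ hF h
  have hcS := complexity_nonneg X Bstar
  have hcH := complexity_nonneg X Bhat
  have e : ∀ B : Matrix (Fin p) (Fin m) ℝ,
      (m : ℝ) * n * σ ^ 2 * scaledComplexity A X B = A * (σ ^ 2 * complexity X B) := by
    intro B
    rw [scaledComplexity]
    rw [mul_right_comm, mul_div_cancel₀ _ hmn.ne']
    ring
  have hA0 : 0 ≤ A := by linarith
  have hδS : 0 ≤ scaledComplexity A X Bstar :=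
    div_nonneg (mul_nonneg hA0 hcS) hmn.le
  have hδH : 0 ≤ scaledComplexity A X Bhat :=
    div_nonneg (mul_nonneg hA0 hcH) hmn.le
  have u1 := mul_le_mul_of_nonneg_right hup hδS
  have u2 := mul_le_mul_of_nonneg_right hlow.le hδH
  have eS := e Bstar
  have eH := e Bhat
  have hsS : 0 ≤ (σ : ℝ) ^ 2 * complexity X Bstar := by positivity
  have hsH : 0 ≤ (σ : ℝ) ^ 2 * complexity X Bhat := by positivity
  have hd0 := sq_nonneg ‖X * Bhat - X * Bstar‖
  rw [mul_add] at hcross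
  generalize ‖X * Bhat - X * Bstar‖ ^ 2 = d at *
  generalize ‖F‖ ^ 2 = a at *
  generalize (σ : ℝ) ^ 2 * complexity X Bstar = cS at *
  generalize (σ : ℝ) ^ 2 * complexity X Bhat = cH at *
  have hwpos : 0 < w := lt_of_lt_of_le (by positivity) hw
  have r1 : (d / 2 - 3072 * (cH + cS)) * w
      ≤ (d - 2 * frobInner F (X * Bhat - X * Bstar)) * w :=
    mul_le_mul_of_nonneg_right (by linarith) hwpos.le
  have r2 : (cH + cS) * w ≤ (cH + cS) * 2 := mul_le_mul_of_nonneg_left hw2 (by linarith)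
  have r3 : d * w₀ ^ 2 ≤ d * w := mul_le_mul_of_nonneg_left hw hd0
  have r4 : 50000 * cH ≤ A * cH := mul_le_mul_of_nonneg_right hA hsH
  -- The terms in `cH` total at most (6144 - A/8) `cH`, which is nonpositive since 50000/8 = 6250.
  rw [div_mul_eq_mul_div, le_div_iff₀ (by positivity)]
  linarith

end Deterministic

end ScaleFreePIC

end

/-! ### Assembly of the events and constants. -/

theorem theorem3 :
    ∃ Amin C c C' c' : ℝ, 0 < Amin ∧ 0 < C ∧ 0 < c ∧ 0 < C' ∧ 0 < c' ∧
      ∀ A A₀ : ℝ, Amin ≤ A → A < A₀ →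
        ∃ K : ℝ, 0 < K ∧
          ∀ (n p m : ℕ) (X : Matrix (Fin n) (Fin p) ℝ) (Bstar : Matrix (Fin p) (Fin m) ℝ)
            (σ : ℝ≥0) (Ω : Type*) [MeasurableSpace Ω] (P : Measure Ω) [IsProbabilityMeasure P]
            (E : Ω → Matrix (Fin n) (Fin m) ℝ),
            0 < σ →
            ScaleFreePIC.IsGaussianNoise P σ E →
            ScaleFreePIC.complexity X Bstar < (m : ℝ) * (n : ℝ) / A₀ →
            ∃ S : Set Ω, MeasurableSet S ∧
              1 - C * (p : ℝ) ^ (-c) - C' * Real.exp (-c' * ((m : ℝ) * (n : ℝ))) ≤ P.real S ∧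
              ∀ ω ∈ S, ∀ Bhat : Matrix (Fin p) (Fin m) ℝ,
                ScaleFreePIC.IsScaleFreeMinimizer A X (X * Bstar + E ω) Bhat →
                ‖X * Bhat - X * Bstar‖ ^ 2
                  ≤ K * ((σ : ℝ) ^ 2 * ScaleFreePIC.complexity X Bstar) := by
  refine ⟨50000, 3, 1, 2, 1 / 4, by norm_num, by norm_num, by norm_num, by norm_num, by norm_num,
    fun A A₀ hA hA₀ => ?_⟩
  have hA0 : 0 < A := by linarith
  have hA₀0 : 0 < A₀ := by linarith
  have hw₀ : 0 < 1 - A / A₀ := by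
    rw [sub_pos, div_lt_one hA₀0]
    exact hA₀
  refine ⟨2 * (6144 + 448 * A) / (1 - A / A₀) ^ 2, by positivity, ?_⟩
  intro n p m X Bstar σ Ω _ P _ E hσ hE hcomp
  have hcS := ScaleFreePIC.complexity_nonneg X Bstar
  -- For p = 0 the power p^(-1) is 0 by convention, so it gives no room; all coefficient matrices
  -- coincide and the whole space serves.
  rcases Nat.eq_zero_or_pos p with rfl | hp
  · refine ⟨Set.univ, MeasurableSet.univ, ?_, fun ω _ Bhat _ => ?_⟩
    · have h1 : (0 : ℝ) ≤ ((0 : ℕ) : ℝ) ^ (-1 : ℝ) := by positivity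
      have h2 := Real.exp_pos (-(1 / 4) * ((m : ℝ) * n))
      simp only [probReal_univ]
      linarith
    · rw [Subsingleton.elim Bhat Bstar, sub_self, norm_zero, zero_pow two_ne_zero]
      exact mul_nonneg (by positivity) (mul_nonneg (by positivity) hcS)
  have hmn : (0 : ℝ) < (m : ℝ) * n := by
    have := hcS.trans_lt hcomp
    rwa [div_pos_iff_of_pos_right hA₀0] at this
  have hδ : ScaleFreePIC.scaledComplexity A X Bstar ≤ 1 - (1 - A / A₀) := by
    rw [ScaleFreePIC.scaledComplexity, sub_sub_cancel, div_le_div_iff₀ hmn hA₀0]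
    rw [lt_div_iff₀ hA₀0] at hcomp
    nlinarith
  obtain ⟨M, hMs, hMi, hMX, R, hMR⟩ := ScaleFreePIC.exists_proj_columns (X * Bstar)
  have p1 := ScaleFreePIC.measure_not_sparse_noiseBound_le hσ hE X
  have p2 := ScaleFreePIC.measure_not_sparse_noiseBound_le hσ hE ((1 - M) * X)
  have hlogp : 0 ≤ Real.log p := Real.log_nonneg (by exact_mod_cast hp)
  have p3 := ScaleFreePIC.measure_not_noiseBound_le hσ hE (X * Bstar) hlogp
  have p4 := ScaleFreePIC.measure_not_noiseBound_le hσ hE (1 : Matrix (Fin n) (Fin n) ℝ) hmn.le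
  have p5 := ScaleFreePIC.measure_sq_norm_noise_le hσ hE
  rw [Real.exp_neg, Real.exp_log (by exact_mod_cast hp)] at p3
  have p4' : Real.exp (-((m : ℝ) * n)) ≤ Real.exp (-(1 / 4) * ((m : ℝ) * n)) := by
    gcongr
    linarith
  set S₁ := {ω | ¬ ∀ (J : Finset (Fin p)) (C : Matrix (Fin p) (Fin m) ℝ),
    ScaleFreePIC.NoiseBound σ (E ω) (min X.rank J.card) (3 * ScaleFreePIC.sparsityTerm p J.card)
      (X * (ScaleFreePIC.rowSelector J * C))} with hS₁
  set S₂ := {ω | ¬ ∀ (J : Finset (Fin p)) (C : Matrix (Fin p) (Fin m) ℝ),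
    ScaleFreePIC.NoiseBound σ (E ω) (min ((1 - M) * X).rank J.card)
      (3 * ScaleFreePIC.sparsityTerm p J.card)
      ((1 - M) * X * (ScaleFreePIC.rowSelector J * C))} with hS₂
  set S₃ := {ω | ¬ ∀ C : Matrix (Fin m) (Fin m) ℝ,
    ScaleFreePIC.NoiseBound σ (E ω) (X * Bstar).rank (Real.log p) (X * Bstar * C)} with hS₃
  set S₄ := {ω | ¬ ∀ C : Matrix (Fin n) (Fin m) ℝ,
    ScaleFreePIC.NoiseBound σ (E ω) (1 : Matrix (Fin n) (Fin n) ℝ).rank ((m : ℝ) * n)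
      ((1 : Matrix (Fin n) (Fin n) ℝ) * C)} with hS₄
  set S₅ := {ω | ‖E ω‖ ^ 2 ≤ (m : ℝ) * n * σ ^ 2 / 4} with hS₅
  have hbad : P.real (S₁ ∪ S₂ ∪ S₃ ∪ S₄ ∪ S₅)
      ≤ 3 * (p : ℝ)⁻¹ + 2 * Real.exp (-(1 / 4) * ((m : ℝ) * n)) := by
    have q1 := measureReal_union_le (μ := P) (S₁ ∪ S₂ ∪ S₃ ∪ S₄) S₅
    have q2 := measureReal_union_le (μ := P) (S₁ ∪ S₂ ∪ S₃) S₄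
    have q3 := measureReal_union_le (μ := P) (S₁ ∪ S₂) S₃
    have q4 := measureReal_union_le (μ := P) S₁ S₂
    linarith
  -- A measurable hull of the bad set has the same measure, so measurability of the events need not
  -- be checked.
  refine ⟨(toMeasurable P (S₁ ∪ S₂ ∪ S₃ ∪ S₄ ∪ S₅))ᶜ, (measurableSet_toMeasurable _ _).compl,
    ?_, fun ω hω Bhat hB => ?_⟩
  · rw [probReal_compl_eq_one_sub (measurableSet_toMeasurable _ _), measureReal_def,
      measure_toMeasurable, ← measureReal_def, Real.rpow_neg_one]
    linarith
  · have hω' : ω ∉ S₁ ∪ S₂ ∪ S₃ ∪ S₄ ∪ S₅ := fun h => hω (subset_toMeasurable P _ h)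
    simp only [Set.mem_union, not_or] at hω'
    obtain ⟨⟨⟨⟨g1, g2⟩, g3⟩, g4⟩, g5⟩ := hω'
    exact ScaleFreePIC.sq_norm_le_of_isScaleFreeMinimizer hA hσ hmn hw₀ hδ
      (by linarith [div_pos hA0 hA₀0]) (not_le.1 g5)
      (ScaleFreePIC.sq_norm_le_of_noiseBound (not_not.1 g4))
      (ScaleFreePIC.two_mul_frobInner_le hMs hMi hMX hMR (not_not.1 g1) (not_not.1 g2)
        (not_not.1 g3) Bhat) hB
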